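/- Let $p$ be a prime, let $(R,\mathfrak m)$ be a Noetherian local ring of characteristic $p$ that is $F$-pure, i.e. the inclusion $R\hookrightarrow R^{1/p}$ is a pure map of $R$-modules (equivalently, the Frobenius map $R\to R$, with the target regarded as an $R$-module through it, is pure). Let $M\neq 0$ be a finitely generated $R$-module. For $e\ge 0$ and $q=p^e$ let $F^e(M)=R^{1/q}\otimes_R M$, where $R$ acts on the left by $r\cdot(a^{1/q}\otimes m)=(ra)^{1/q}\otimes m$ (so $F^e(M)$ is the base change of $M$ along the $e$-th iterate of the Frobenius map), and let $\operatorname{depth}_R(F^e(M))$ be the supremum of the lengths of $F^e(M)$-regular sequences in $\mathfrak m$. Let $R^\infty=\bigcup_e R^{1/p^e}$ be the perfect closure of $R$; it is a local ring, with maximal ideal $\mathfrak m^\infty$. For a local ring $(S,\mathfrak n)$ and an $S$-module $N$ with $N\ne\mathfrak nN$, the Koszul depth $\operatorname{k\,depth}_S(N)$ is the supremum of $n-h$ over all finite sequences $\mathbf x=x_1,\dots,x_n$ in $\mathfrak n$, where $h$ is the highest index with $H_h(\mathbf x;N)\neq 0$, and $H_\bullet(\mathbf x;N)$ is the homology of the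 Koszul complex $K_\bullet(\mathbf x;N)$. Then $\operatorname{depth}_R(F^e(M))$ is constant for $e\gg0$; let $\operatorname{sdepth}_R(M)$ (the stabilizing depth) be this constant value. Moreover $\operatorname{k\,depth}_{R^\infty}(R^\infty\otimes_R M)$ is finite, and $$\operatorname{k\,depth}_{R^\infty}(R^\infty\otimes_R M)=\operatorname{sdepth}_R(M).$$ -/

import Mathlib

open scoped TensorProduct

universe u v w

noncomputable section

/-! ### Koszul homology, Koszul grade and depth over an arbitrary commutative ring -/

section Koszul

variable {S : Type u} [CommRing S] {n : ℕ} (x : Fin n → S) (M : Type v) [AddCommGroup M] [Module S M]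

/-- The differential of the Koszul complex `K(x₁, …, xₙ; M)`. A chain `∑ₛ e_s ⊗ c(s)`, where `s` runs
over the subsets of `{1, …, n}` and `e_s` is the wedge of the `e_i`, `i ∈ s`, in increasing order, is
stored as the function `c`. The rule
`d (e_s ⊗ m) = ∑_{i ∈ s} (-1)^{#{k ∈ s | k < i}} e_{s ∖ {i}} ⊗ x_i m` then reads as follows. -/
def koszulD : (Finset (Fin n) → M) →ₗ[S] (Finset (Fin n) → M) where
  toFun c t := ∑ i ∈ tᶜ, ((-1 : S) ^ (t.filter (· < i)).card * x i) • c (insert i t)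
  map_add' c c' := by
    funext t
    simp [smul_add, Finset.sum_add_distrib]
  map_smul' a c := by
    funext t
    simp [Finset.smul_sum, smul_comm a]

/-- The chains of degree `j`: those supported on the subsets with `j` elements (so a copy of
`M ^ (n choose j)`). -/
def koszulChains (S : Type u) [CommRing S] (n : ℕ) (M : Type v) [AddCommGroup M] [Module S M]
    (j : ℕ) : Submodule S (Finset (Fin n) → M) where
  carrier := {c | ∀ s, s.card ≠ j → c s = 0}
  add_mem' {c c'} hc hc' s hs := by simp [hc s hs, hc' s hs]
  zero_mem' _ _ := rfl
  smul_mem' a c hc s hs := by simp [hc s hs]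

/-- The cycles of degree `j`. -/
def koszulCycles (j : ℕ) : Submodule S (Finset (Fin n) → M) :=
  koszulChains S n M j ⊓ LinearMap.ker (koszulD x M)

/-- The boundaries of degree `j`. -/
def koszulBoundaries (j : ℕ) : Submodule S (Finset (Fin n) → M) :=
  (koszulChains S n M (j + 1)).map (koszulD x M)

variable {M}

theorem koszulD_mem_chains {j : ℕ} {c : Finset (Fin n) → M}
    (hc : c ∈ koszulChains S n M (j + 1)) : koszulD x M c ∈ koszulChains S n M j := by
  intro t ht
  refine Finset.sum_eq_zero fun i hi => ?_
  rw [hc (insert i t) (by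
    rw [Finset.card_insert_of_notMem (Finset.mem_compl.mp hi)]; omega), smul_zero]

theorem koszulD_koszulD (c : Finset (Fin n) → M) : koszulD x M (koszulD x M c) = 0 := by
  funext t
  simp only [koszulD, LinearMap.coe_mk, AddHom.coe_mk, Finset.smul_sum, smul_smul, Pi.zero_apply]
  rw [Finset.sum_sigma']
  refine Finset.sum_involution (fun a _ => ⟨a.2, a.1⟩) ?_ ?_ ?_ ?_
  · rintro ⟨i, k⟩ h
    simp only [Finset.mem_sigma, Finset.mem_compl, Finset.mem_insert, not_or] at h
    obtain ⟨hi, hki, hk⟩ := h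
    rw [Finset.insert_comm k i t, ← add_smul]
    have key : ∀ {i k : Fin n}, i ∉ t → k ∉ t → i < k →
        ((-1 : S) ^ (t.filter (· < i)).card * x i) *
          ((-1) ^ ((insert i t).filter (· < k)).card * x k) +
        ((-1 : S) ^ (t.filter (· < k)).card * x k) *
          ((-1) ^ ((insert k t).filter (· < i)).card * x i) = 0 := by
      intro i k hi hk hik
      rw [Finset.filter_insert, if_pos hik, Finset.filter_insert, if_neg (not_lt.mpr hik.le),
        Finset.card_insert_of_notMem (by simp [hi])]
      ring
    rcases lt_or_gt_of_ne (Ne.symm hki) with h1 | h1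
    · rw [key hi hk h1, zero_smul]
    · rw [add_comm, key hk hi h1, zero_smul]
  · rintro ⟨i, k⟩ h - heq
    simp only [Finset.mem_sigma, Finset.mem_compl, Finset.mem_insert, not_or] at h
    simp only [Sigma.mk.injEq] at heq
    exact h.2.1 heq.1
  · rintro ⟨i, k⟩ h
    simp only [Finset.mem_sigma, Finset.mem_compl, Finset.mem_insert, not_or] at h ⊢
    exact ⟨h.2.2, fun e => h.2.1 e.symm, h.1⟩
  · rintro ⟨i, k⟩ h
    rfl

theorem koszulBoundaries_le_cycles (j : ℕ) : koszulBoundaries x M j ≤ koszulCycles x M j := by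
  rintro _ ⟨c, hc, rfl⟩
  exact ⟨koszulD_mem_chains x hc, koszulD_koszulD x c⟩

variable (M)

/-- The Koszul homology module `H_j(x₁, …, xₙ; M)`, cycles modulo boundaries. -/
abbrev KoszulHomology (j : ℕ) : Type v :=
  koszulCycles x M j ⧸ (koszulBoundaries x M j).submoduleOf (koszulCycles x M j)

/-- The Koszul grade `n - h` of a finite sequence `x₁, …, xₙ` on `M`, where `h` is the highest index
with `H_h(x; M) ≠ 0`; as `j ↦ n - j` is decreasing, this is the least value of `n - j` over all `j`
with `H_j(x; M) ≠ 0` (such `j` are at most `n`). It is `⊤` if all the homology vanishes. -/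
def koszulGradeSeq : ℕ∞ :=
  ⨅ (j : ℕ) (_ : Nontrivial (KoszulHomology x M j)), ((n - j : ℕ) : ℕ∞)

/-- The Koszul grade of an ideal on `M`: the supremum over the finite sequences in `I`. -/
def koszulGrade {S : Type u} [CommRing S] (I : Ideal S) (M : Type v) [AddCommGroup M]
    [Module S M] : ℕ∞ :=
  ⨆ (n : ℕ) (x : Fin n → S) (_ : ∀ i, x i ∈ I), koszulGradeSeq x M

/-- The Koszul depth over a local ring. -/
def koszulDepth (S : Type u) [CommRing S] [IsLocalRing S] (M : Type v) [AddCommGroup M]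
    [Module S M] : ℕ∞ :=
  koszulGrade (IsLocalRing.maximalIdeal S) M

end Koszul

/-- The depth over a local ring: the supremum of the lengths of the `M`-regular sequences in the
maximal ideal. -/
def localDepth (S : Type u) [CommRing S] [IsLocalRing S] (M : Type v) [AddCommGroup M]
    [Module S M] : ℕ∞ :=
  ⨆ (rs : List S) (_ : ∀ r ∈ rs, r ∈ IsLocalRing.maximalIdeal S)
    (_ : RingTheory.Sequence.IsRegular M rs), (rs.length : ℕ∞)

/-- A pure map of `S`-modules: injective after tensoring with any `S`-module. (Every element of
`A ⊗ N` that maps to zero in `B ⊗ N` already does so for a finitely generated submodule of `N`, so the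
modules in the universe of `S` suffice.) -/
def IsPureMap {S : Type u} [CommRing S] {A : Type v} {B : Type w} [AddCommGroup A] [AddCommGroup B]
    [Module S A] [Module S B] (f : A →ₗ[S] B) : Prop :=
  ∀ (N : Type u) [AddCommGroup N] [Module S N], Function.Injective (f.rTensor N)

/-! ### The Frobenius functor, F-purity, the perfect closure -/

section Frobenius

variable (R : Type u) [CommRing R] (p : ℕ) [Fact p.Prime] [CharP R p]

/-- The `R`-algebra `R^{1/q}`, `q = p ^ e`: the ring `R`, whose element `a` stands for `a^{1/q}`, with
structure map the `e`-th iterate `r ↦ r ^ q` of the Frobenius map (the inclusion `R ⊆ R^{1/q}`). -/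
@[nolint unusedArguments]
def FrobeniusRoot (R : Type u) [CommRing R] (p : ℕ) [Fact p.Prime] [CharP R p] (_e : ℕ) : Type u := R

instance (e : ℕ) : CommRing (FrobeniusRoot R p e) := inferInstanceAs (CommRing R)

instance (e : ℕ) : Algebra R (FrobeniusRoot R p e) :=
  RingHom.toAlgebra (R := R) (S := FrobeniusRoot R p e) (iterateFrobenius R p e)

/-- The identification `r ↦ r^{1/q}` of the ring `R` with `R^{1/q}`. It gives the left action of `R`. -/
def toFrobeniusRoot (e : ℕ) : R ≃+* FrobeniusRoot R p e := RingEquiv.refl R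

/-- A ring of characteristic `p` is F-pure if `R → R^{1/p}` is a pure map of `R`-modules. -/
def IsFPure : Prop := IsPureMap (Algebra.linearMap R (FrobeniusRoot R p 1))

variable (M : Type v) [AddCommGroup M] [Module R M]

/-- The `e`-th iterate `F^e(M) = R^{1/q} ⊗_R M` of the Frobenius functor. -/
def FrobeniusFunctor (e : ℕ) : Type max u v := FrobeniusRoot R p e ⊗[R] M

instance (e : ℕ) : AddCommGroup (FrobeniusFunctor R p M e) :=
  inferInstanceAs (AddCommGroup (FrobeniusRoot R p e ⊗[R] M))

/-- The (left) `R`-module structure `r • (a^{1/q} ⊗ m) = (r a)^{1/q} ⊗ m` on `F^e(M)`. -/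
instance (e : ℕ) : Module R (FrobeniusFunctor R p M e) :=
  Module.compHom (FrobeniusRoot R p e ⊗[R] M) (toFrobeniusRoot R p e).toRingHom

/-- The stabilizing depth: the value of `depth_R F^e(M)` for all large `e`. The upper limit is that
value whenever the sequence is eventually constant. -/
def stabilizingDepth [IsLocalRing R] : ℕ∞ :=
  Filter.limsup (fun e : ℕ => localDepth R (FrobeniusFunctor R p M e)) Filter.atTop

instance : Algebra R (PerfectClosure R p) := (PerfectClosure.of R p).toAlgebra

instance [IsLocalRing R] : IsLocalRing (PerfectClosure R p) := by
  have : Nontrivial (PerfectClosure R p) :=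
    CharP.nontrivial_of_char_ne_one (v := p) (Fact.out : p.Prime).ne_one
  refine IsLocalRing.of_isUnit_or_isUnit_one_sub_self fun y => ?_
  obtain ⟨k, a, ha⟩ := IsPRadical.pow_mem (i := PerfectClosure.of R p) (p := p) y
  have hp : p ^ k ≠ 0 := pow_ne_zero _ (Fact.out : p.Prime).ne_zero
  rcases IsLocalRing.isUnit_or_isUnit_one_sub_self a with h | h
  · exact Or.inl ((isUnit_pow_iff hp).mp (ha ▸ h.map (PerfectClosure.of R p)))
  · refine Or.inr ((isUnit_pow_iff hp).mp ?_)
    have h2 := h.map (PerfectClosure.of R p)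
    rwa [map_sub, map_one, ha, ← one_pow (p ^ k), ← sub_pow_char_pow] at h2

end Frobenius

end

/-!
Write `q = p ^ e`, `R^∞` for the perfect closure and `T = R^∞ ⊗ M`. Everything is read off from the
vanishing of Koszul homology, by two facts.

*Depth sensitivity.* Let `N ≠ 0` be a finite module over a Noetherian local ring and `x` a finite
sequence in the maximal ideal. The Koszul grade of `x` on `N` is at most `depth N`
(`koszulGradeSeq_le_localDepth`): if it is positive, the top Koszul homology vanishes and prime
avoidance gives a regular element of `(x)`, modulo which the grade drops by at most one. If moreover
`(x)` is primary to the maximal ideal, equality holds (`localDepth_le_koszulGradeSeq`): a regular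
element `r` with a power in `(x)` is nilpotent on the Koszul homology, so that `H_j(x; N) ≠ 0` forces
`H_{j+1}(x; N/rN) ≠ 0`.

*Purity.* F-purity makes `R → R^∞` pure (`IsFPure.eq_zero_of_finite`). As `T` is the base change of
`F^e(M)` along `a ↦ a^{1/q}`, the maps `F^e(M) → T` induce injections
`H_j(x; F^e(M)) → H_j(x^{1/q}; T)` (`mem_koszulBoundaries_of_toPerfectClosure`). Since `T` is the
increasing union of the images of the `F^e(M)`, conversely a nonzero class over `T` is a nonzero class
over `F^e(M)` for all large `e` (`eventually_nontrivial_koszulHomology`).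

Let now `y` generate the maximal ideal of `R`. By depth sensitivity, `depth F^e(M)` is the Koszul grade
of the powers `y i ^ q` on `F^e(M)`; by purity this is the Koszul grade of `y` on `T` for large `e`,
whence the depth stabilizes. An arbitrary finite sequence in the maximal ideal of `R^∞` has the form
`x^{1/q}`, and its Koszul grade is at most that of `x` on `F^e(M)`, hence at most `depth F^e(M)`.
-/

/-! ### Koszul homology: functoriality, matrix form, the contracting homotopies -/

section KoszulBasic

variable {S : Type u} [CommRing S] {n : ℕ} (x : Fin n → S) {M : Type v} [AddCommGroup M]
  [Module S M]

theorem koszulD_apply (c : Finset (Fin n) → M) (t : Finset (Fin n)) :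
    koszulD x M c t = ∑ i ∈ tᶜ, ((-1 : S) ^ (t.filter (· < i)).card * x i) • c (insert i t) :=
  rfl

theorem mem_koszulCycles {j : ℕ} {c : Finset (Fin n) → M} :
    c ∈ koszulCycles x M j ↔ c ∈ koszulChains S n M j ∧ koszulD x M c = 0 :=
  Iff.rfl

theorem nontrivial_koszulHomology_iff {j : ℕ} :
    Nontrivial (KoszulHomology x M j) ↔ ∃ z ∈ koszulCycles x M j, z ∉ koszulBoundaries x M j := by
  rw [Submodule.Quotient.nontrivial_iff, ne_eq, Submodule.submoduleOf, Submodule.comap_subtype_eq_top,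
    SetLike.not_le_iff_exists]

theorem koszulD_eq_zero_of_mem_chains_zero {c : Finset (Fin n) → M}
    (hc : c ∈ koszulChains S n M 0) : koszulD x M c = 0 := by
  funext t
  rw [koszulD_apply]
  exact Finset.sum_eq_zero fun i _ => by rw [hc _ (by simp), smul_zero]

theorem eq_zero_of_mem_chains_of_lt {j : ℕ} (hj : n < j) {c : Finset (Fin n) → M}
    (hc : c ∈ koszulChains S n M j) : c = 0 := by
  funext s
  refine hc s fun h => ?_
  have := s.card_le_univ
  rw [Fintype.card_fin] at this
  omega

theorem le_of_nontrivial_koszulHomology {j : ℕ} (h : Nontrivial (KoszulHomology x M j)) :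
    j ≤ n := by
  obtain ⟨z, hz, hzB⟩ := (nontrivial_koszulHomology_iff x).1 h
  by_contra! hj
  rw [eq_zero_of_mem_chains_of_lt hj hz.1] at hzB
  exact hzB (zero_mem _)

theorem single_mem_koszulChains (s : Finset (Fin n)) (v : M) :
    Pi.single s v ∈ koszulChains S n M s.card := by
  intro t ht
  exact Pi.single_eq_of_ne (fun h => ht (congrArg Finset.card h)) _

variable {B : Type*} [CommRing B] {f : S →+* B} {T : Type*} [AddCommGroup T] [Module B T]

/-- The differential is given by a matrix with entries in the ring, indexed by subsets; along a ring
homomorphism the entries are mapped. -/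
theorem koszulD_comp_eq_sum (c : Finset (Fin n) → T) (t : Finset (Fin n)) :
    koszulD (f ∘ x) T c t = ∑ s, f (koszulD x S (Pi.single s 1) t) • c s := by
  simp only [koszulD_apply, map_sum, Finset.sum_smul, smul_eq_mul]
  refine Eq.trans ?_ Finset.sum_comm
  refine Finset.sum_congr rfl fun i _ => ?_
  rw [Finset.sum_eq_single (insert i t)]
  · simp
  · intro s _ hs
    rw [Pi.single_eq_of_ne hs.symm, mul_zero, map_zero, zero_smul]
  · simp

/-- The columns of the matrix of the differential. -/
theorem koszulD_single (s : Finset (Fin n)) (v : M) :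
    koszulD x M (Pi.single s v) =
      ∑ t, koszulD x S (Pi.single s 1) t • (Pi.single t v : Finset (Fin n) → M) := by
  funext t
  have h := koszulD_comp_eq_sum (f := RingHom.id S) x (Pi.single s v) t
  rw [Finset.sum_eq_single s (fun t' _ h' => by rw [Pi.single_eq_of_ne h', smul_zero]) (by simp),
    Pi.single_eq_same] at h
  refine h.trans ?_
  rw [Finset.sum_apply, Finset.sum_eq_single t]
  · simp
  · intro t' _ h'
    rw [Pi.smul_apply, Pi.single_eq_of_ne h'.symm, smul_zero]
  · simp

theorem koszulD_map (φ : M →ₛₗ[f] T) (c : Finset (Fin n) → M) :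
    koszulD (f ∘ x) T (φ ∘ c) = φ ∘ koszulD x M c := by
  funext t
  simp [koszulD_apply]

theorem comp_mem_koszulChains (φ : M →ₛₗ[f] T) {j : ℕ} {c : Finset (Fin n) → M}
    (hc : c ∈ koszulChains S n M j) : φ ∘ c ∈ koszulChains B n T j := fun s hs => by
  simp [hc s hs]

theorem comp_mem_koszulBoundaries (φ : M →ₛₗ[f] T) {j : ℕ} {c : Finset (Fin n) → M}
    (hc : c ∈ koszulBoundaries x M j) : φ ∘ c ∈ koszulBoundaries (f ∘ x) T j := by
  obtain ⟨b, hb, rfl⟩ := hc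
  exact ⟨φ ∘ b, comp_mem_koszulChains φ hb, koszulD_map x φ b⟩

theorem exists_lift_mem_koszulChains (φ : M →ₛₗ[f] T) {j : ℕ} {c : Finset (Fin n) → T}
    (hc : c ∈ koszulChains B n T j) (h : ∀ s, c s ∈ Set.range φ) :
    ∃ b ∈ koszulChains S n M j, φ ∘ b = c := by
  choose b hb using h
  refine ⟨fun s => if s.card = j then b s else 0, fun s hs => if_neg hs, ?_⟩
  funext s
  by_cases hs : s.card = j
  · simp [hs, hb]
  · simp [hs, hc s hs]

/-- Exterior multiplication by the `i`-th basis vector, on the chains of the Koszul complex. -/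
def koszulWedge (i : Fin n) (c : Finset (Fin n) → M) (s : Finset (Fin n)) : M :=
  if i ∈ s then (-1 : S) ^ (s.filter (· < i)).card • c (s.erase i) else 0

theorem koszulWedge_mem_chains (i : Fin n) {j : ℕ} {c : Finset (Fin n) → M}
    (hc : c ∈ koszulChains S n M j) : koszulWedge (S := S) i c ∈ koszulChains S n M (j + 1) := by
  intro s hs
  rw [koszulWedge]
  split_ifs with h
  · rw [hc _ (by have := Finset.card_erase_add_one h; omega), smul_zero]
  · rfl

/-- Exterior multiplication by the `i`-th basis vector is a homotopy between multiplication by `x i`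
and zero. -/
theorem koszulD_koszulWedge_add (i : Fin n) (c : Finset (Fin n) → M) :
    koszulD x M (koszulWedge (S := S) i c) + koszulWedge (S := S) i (koszulD x M c) = x i • c := by
  have sq : ∀ (k : ℕ), ((-1 : S) ^ k) * (-1) ^ k = 1 := fun k => by
    rw [← mul_pow]; simp
  funext t
  rw [Pi.add_apply, Pi.smul_apply]
  by_cases hi : i ∈ t
  -- Writing `t = u ∪ {i}`, the term of `koszulD x M c u` at `i` gives `x i • c t`; the terms at the
  -- other indices cancel.
  · obtain ⟨u, hu, rfl⟩ : ∃ u, i ∉ u ∧ t = insert i u :=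
      ⟨t.erase i, by simp, (Finset.insert_erase hi).symm⟩
    have hc : uᶜ = insert i (insert i u)ᶜ := by
      ext k; by_cases hk : k = i <;> simp [hk, hu]
    rw [koszulWedge, if_pos hi, Finset.erase_insert hu, koszulD_apply x c u, hc,
      Finset.sum_insert (by simp), koszulD_apply, smul_add, ← add_assoc, add_right_comm,
      Finset.filter_insert, if_neg (lt_irrefl _), smul_smul, ← mul_assoc, sq, one_mul,
      Finset.smul_sum, ← Finset.sum_add_distrib, Finset.sum_eq_zero, zero_add]
    intro k hk
    have hki : k ≠ i := fun h => by simp [h] at hk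
    have hku : k ∉ u := fun h => by simp [h] at hk
    rw [koszulWedge, if_pos (by simp), smul_smul, smul_smul, Finset.insert_comm k i u,
      Finset.erase_insert (by simp [hki.symm, hu]), ← add_smul]
    convert zero_smul S _
    rw [Finset.filter_insert, Finset.filter_insert, if_neg (lt_irrefl _), Finset.filter_insert]
    rcases lt_or_gt_of_ne hki with h | h
    · rw [if_neg (not_lt.2 h.le), if_pos h, Finset.card_insert_of_notMem (by simp [hku])]
      ring
    · rw [if_pos h, if_neg (not_lt.2 h.le), Finset.card_insert_of_notMem (by simp [hu])]
      ring
  · rw [koszulWedge, if_neg hi, add_zero, koszulD_apply, Finset.sum_eq_single i]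
    · rw [koszulWedge, if_pos (by simp), Finset.erase_insert hi, smul_smul, Finset.filter_insert,
        if_neg (lt_irrefl _), mul_right_comm, sq, one_mul]
    · intro k _ hki
      rw [koszulWedge, if_neg (by simp [hki.symm, hi]), smul_zero]
    · simp [hi]

/-- The ideal `(x)` annihilates the Koszul homology of `x`. -/
theorem smul_mem_koszulBoundaries {j : ℕ} {z : Finset (Fin n) → M} (hz : z ∈ koszulCycles x M j)
    {a : S} (ha : a ∈ Ideal.span (Set.range x)) : a • z ∈ koszulBoundaries x M j := by
  have hle : Ideal.span (Set.range x) ≤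
      (koszulBoundaries x M j).comap (LinearMap.toSpanSingleton S _ z) := by
    refine Submodule.span_le.2 ?_
    rintro _ ⟨i, rfl⟩
    refine ⟨koszulWedge (S := S) i z, koszulWedge_mem_chains i hz.1, ?_⟩
    have h := koszulD_koszulWedge_add x i z
    have h0 : koszulWedge (S := S) i (koszulD x M z) = 0 := by
      rw [LinearMap.mem_ker.1 hz.2]
      funext s
      simp [koszulWedge]
    rwa [h0, add_zero] at h
  exact hle ha

end KoszulBasic

/-! ### Koszul homology and regular elements -/

section KoszulRegular

open scoped Pointwise

variable {S : Type u} [CommRing S] {n : ℕ} (x : Fin n → S) {M : Type v} [AddCommGroup M]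
  [Module S M]

/-- Any chain whose reduction modulo a regular element `r` vanishes is `r` times a chain of the same
degree. -/
theorem exists_eq_smul_of_mkQ_comp_eq_zero {r : S} (hr : IsSMulRegular M r) {j : ℕ}
    {c : Finset (Fin n) → M} (hc : c ∈ koszulChains S n M j)
    (h : (r • (⊤ : Submodule S M)).mkQ ∘ c = 0) :
    ∃ b ∈ koszulChains S n M j, c = r • b := by
  have h' : ∀ s, ∃ y, r • y = c s := fun s => by
    have := congrFun h s
    simp only [Function.comp_apply, Pi.zero_apply, Submodule.mkQ_apply,
      Submodule.Quotient.mk_eq_zero] at this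
    obtain ⟨y, -, hy⟩ := (Submodule.mem_smul_pointwise_iff_exists _ _ _).1 this
    exact ⟨y, hy⟩
  choose b hb using h'
  refine ⟨b, fun s hs => hr ?_, funext fun s => (hb s).symm⟩
  simp only
  rw [hb, hc s hs, smul_zero]

theorem smul_left_injective_chains {r : S} (hr : IsSMulRegular M r) {b c : Finset (Fin n) → M}
    (h : r • b = r • c) : b = c :=
  funext fun s => hr (congrFun h s)

theorem mkQ_comp_smul (r : S) (c : Finset (Fin n) → M) :
    (r • (⊤ : Submodule S M)).mkQ ∘ (r • c) = 0 := by
  funext s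
  simp only [Function.comp_apply, Pi.zero_apply, Submodule.mkQ_apply, Pi.smul_apply,
    Submodule.Quotient.mk_eq_zero]
  exact Submodule.smul_mem_pointwise_smul _ _ _ trivial

/-- If some power of the regular element `r` lies in the ideal `(x)`, then `r` is nilpotent on
`H_j(x; M)`; a nonzero class killed by `r` comes, through the connecting map, from a nonzero class
in `H_{j+1}(x; M/rM)`. -/
theorem nontrivial_koszulHomology_succ_quotSMulTop {r : S} (hr : IsSMulRegular M r) {k : ℕ}
    (hk : r ^ k ∈ Ideal.span (Set.range x)) {j : ℕ} (h : Nontrivial (KoszulHomology x M j)) :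
    Nontrivial (KoszulHomology x (QuotSMulTop r M) (j + 1)) := by
  rw [nontrivial_koszulHomology_iff] at h ⊢
  obtain ⟨z₀, hz₀, hz₀B⟩ := h
  obtain ⟨z, hz, hzB, hrz⟩ : ∃ z ∈ koszulCycles x M j, z ∉ koszulBoundaries x M j ∧
      r • z ∈ koszulBoundaries x M j := by
    -- The last multiple `r ^ m • z₀` which is not a boundary.
    classical
    have hex : ∃ m, r ^ m • z₀ ∈ koszulBoundaries x M j := ⟨k, smul_mem_koszulBoundaries x hz₀ hk⟩
    obtain ⟨m, hm⟩ : ∃ m, Nat.find hex = m + 1 := Nat.exists_eq_succ_of_ne_zero fun h0 => by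
      have := Nat.find_spec hex
      rw [h0, pow_zero, one_smul] at this
      exact hz₀B this
    refine ⟨r ^ m • z₀, Submodule.smul_mem _ _ hz₀, Nat.find_min hex (by omega), ?_⟩
    rw [smul_smul, ← pow_succ', ← hm]
    exact Nat.find_spec hex
  obtain ⟨b, hb, hbz⟩ := hrz
  let π := (r • (⊤ : Submodule S M)).mkQ
  have hD : ∀ c, koszulD x (QuotSMulTop r M) (π ∘ c) = π ∘ koszulD x M c := koszulD_map x π
  refine ⟨π ∘ b, (mem_koszulCycles x).2 ⟨comp_mem_koszulChains π hb, ?_⟩, ?_⟩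
  · rw [hD, hbz]
    exact mkQ_comp_smul r z
  · rintro ⟨c, hc, hcb⟩
    obtain ⟨c, hc', rfl⟩ := exists_lift_mem_koszulChains π hc
      (fun s => Submodule.mkQ_surjective _ (c s))
    rw [hD] at hcb
    obtain ⟨b', hb', hbb'⟩ := exists_eq_smul_of_mkQ_comp_eq_zero hr
      (sub_mem hb (koszulD_mem_chains x hc')) (by
        funext s
        have := congrFun hcb s
        simp only [Function.comp_apply] at this
        change π (b s - koszulD x M c s) = 0
        rw [map_sub, this, sub_self])
    refine hzB ⟨b', hb', smul_left_injective_chains hr ?_⟩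
    rw [← hbz, ← map_smul, ← hbb', map_sub, koszulD_koszulD, sub_zero]

/-- Part of the long exact sequence of `0 → M → M → M/rM → 0`: a nonzero class in `H_j(x; M/rM)`
either lifts to `H_j(x; M)` or has nonzero image in `H_{j-1}(x; M)`. -/
theorem nontrivial_koszulHomology_of_quotSMulTop {r : S} (hr : IsSMulRegular M r) {j : ℕ}
    (h : Nontrivial (KoszulHomology x (QuotSMulTop r M) j)) :
    Nontrivial (KoszulHomology x M j) ∨
      ∃ i, j = i + 1 ∧ Nontrivial (KoszulHomology x M i) := by
  simp only [nontrivial_koszulHomology_iff] at h ⊢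
  obtain ⟨z, ⟨hz, hdz⟩, hzB⟩ := h
  let π := (r • (⊤ : Submodule S M)).mkQ
  have hD : ∀ c, koszulD x (QuotSMulTop r M) (π ∘ c) = π ∘ koszulD x M c := koszulD_map x π
  obtain ⟨z, hz', rfl⟩ := exists_lift_mem_koszulChains π hz
    (fun s => Submodule.mkQ_surjective _ (z s))
  replace hdz : koszulD x (QuotSMulTop r M) (π ∘ z) = 0 := hdz
  rw [hD] at hdz
  by_contra! H
  obtain ⟨H0, H1⟩ := H
  -- `d z` is `r` times a cycle, which is a boundary `d b'`: correct `z` by `r • b'` to get a cycle.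
  obtain ⟨b', hb', hdb'⟩ : ∃ b' ∈ koszulChains S n M j, koszulD x M z = r • koszulD x M b' := by
    cases j with
    | zero => exact ⟨0, zero_mem _, by simp [koszulD_eq_zero_of_mem_chains_zero x hz']⟩
    | succ i =>
      obtain ⟨w, hw, hzw⟩ := exists_eq_smul_of_mkQ_comp_eq_zero hr (koszulD_mem_chains x hz') hdz
      obtain ⟨b', hb', rfl⟩ := H1 i rfl w ⟨hw, smul_left_injective_chains hr (by
        rw [← map_smul, ← hzw, koszulD_koszulD, smul_zero])⟩
      exact ⟨b', hb', hzw⟩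
  obtain ⟨b, hb, hbz⟩ := H0 (z - r • b') <| (mem_koszulCycles x).2
    ⟨sub_mem hz' (Submodule.smul_mem _ _ hb'), by rw [map_sub, map_smul, hdb', sub_self]⟩
  refine hzB ⟨π ∘ b, comp_mem_koszulChains π hb, ?_⟩
  rw [hD, hbz]
  funext s
  have := congrFun (mkQ_comp_smul r b') s
  simp only [Function.comp_apply, Pi.zero_apply] at this
  simp only [Function.comp_apply, Pi.sub_apply, map_sub, π, this, sub_zero]

/-- The easy half of depth sensitivity: a regular sequence of elements having powers in `(x)` has
length at most `n - j` whenever `H_j(x; M) ≠ 0`. -/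
theorem add_length_le_of_isRegular (rs : List S) (N : Type v) [AddCommGroup N] [Module S N]
    (hrs : RingTheory.Sequence.IsRegular N rs)
    (hx : ∀ r ∈ rs, ∃ k, r ^ k ∈ Ideal.span (Set.range x)) {j : ℕ}
    (h : Nontrivial (KoszulHomology x N j)) : j + rs.length ≤ n := by
  induction rs generalizing N j with
  | nil => exact le_of_nontrivial_koszulHomology x h
  | cons r rs ih =>
    obtain ⟨hr, hrs⟩ := (RingTheory.Sequence.isRegular_cons_iff _ _ _).1 hrs
    obtain ⟨k, hk⟩ := hx r (by simp)
    have := ih (QuotSMulTop r N) hrs (fun s hs => hx s (by simp [hs]))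
      (nontrivial_koszulHomology_succ_quotSMulTop x hr hk h)
    simp only [List.length_cons]
    omega

theorem le_koszulGradeSeq_iff {k : ℕ∞} :
    k ≤ koszulGradeSeq x M ↔
      ∀ j, Nontrivial (KoszulHomology x M j) → k ≤ ((n - j : ℕ) : ℕ∞) := by
  simp only [koszulGradeSeq, le_iInf_iff]

theorem koszulGradeSeq_le {j : ℕ} (h : Nontrivial (KoszulHomology x M j)) :
    koszulGradeSeq x M ≤ ((n - j : ℕ) : ℕ∞) :=
  (le_koszulGradeSeq_iff x).1 le_rfl j h

theorem koszulGradeSeq_le_of_imp {S' : Type*} [CommRing S'] {M' : Type*} [AddCommGroup M']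
    [Module S' M'] {x' : Fin n → S'} (h : ∀ j, Nontrivial (KoszulHomology x' M' j) →
      Nontrivial (KoszulHomology x M j)) : koszulGradeSeq x M ≤ koszulGradeSeq x' M' :=
  (le_koszulGradeSeq_iff x').2 fun j hj => koszulGradeSeq_le x (h j hj)

/-- The top Koszul homology is the submodule of `M` annihilated by `(x)`; when it vanishes over a
Noetherian ring, prime avoidance provides an `M`-regular element of `(x)`. -/
theorem exists_isSMulRegular_of_not_nontrivial [IsNoetherianRing S] [Module.Finite S M]
    (h : ¬ Nontrivial (KoszulHomology x M n)) :
    ∃ r ∈ Ideal.span (Set.range x), IsSMulRegular M r := by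
  have key : Subsingleton ((S ⧸ Ideal.span (Set.range x)) →ₗ[S] M) := by
    refine subsingleton_of_forall_eq 0 fun f => ?_
    by_contra hf
    have hv : f (Ideal.Quotient.mk _ 1) ≠ 0 := fun h0 => hf <| by
      refine Submodule.linearMap_qext _ (LinearMap.ext_ring ?_)
      exact h0
    refine h ((nontrivial_koszulHomology_iff x).2
      ⟨Pi.single Finset.univ (f (Ideal.Quotient.mk _ 1)), ⟨?_, ?_⟩, ?_⟩)
    · simpa using single_mem_koszulChains (S := S) (Finset.univ : Finset (Fin n))
        (f (Ideal.Quotient.mk _ 1))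
    · refine LinearMap.mem_ker.2 (funext fun t => ?_)
      rw [koszulD_apply]
      refine Finset.sum_eq_zero fun i _ => ?_
      rw [mul_smul]
      by_cases ht : insert i t = Finset.univ
      · rw [ht, Pi.single_eq_same, ← map_smul]
        have : x i • (Ideal.Quotient.mk (Ideal.span (Set.range x)) 1) = 0 := by
          rw [← Ideal.Quotient.mk_eq_mk, ← Submodule.Quotient.mk_smul, smul_eq_mul, mul_one,
            Submodule.Quotient.mk_eq_zero]
          exact Ideal.subset_span ⟨i, rfl⟩
        rw [this, map_zero, smul_zero]
      · rw [Pi.single_eq_of_ne ht, smul_zero, smul_zero]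
    · rintro ⟨c, hc, hcz⟩
      rw [eq_zero_of_mem_chains_of_lt n.lt_succ_self hc, map_zero] at hcz
      exact hv (by simpa using (congrFun hcz Finset.univ).symm)
  obtain ⟨r, hr, hreg⟩ := IsSMulRegular.subsingleton_linearMap_iff.1 key
  rw [Ideal.annihilator_quotient] at hr
  exact ⟨r, hr, hreg⟩

end KoszulRegular

/-! ### Depth sensitivity of Koszul homology over a Noetherian local ring -/

section DepthSensitivity

open IsLocalRing

variable {S : Type u} [CommRing S] [IsLocalRing S] {n : ℕ} {x : Fin n → S}

theorem le_localDepth {N : Type v} [AddCommGroup N] [Module S N] {rs : List S}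
    (hm : ∀ r ∈ rs, r ∈ maximalIdeal S) (h : RingTheory.Sequence.IsRegular N rs) :
    (rs.length : ℕ∞) ≤ localDepth S N :=
  le_iSup_of_le rs (le_iSup_of_le hm (le_iSup_of_le h le_rfl))

/-- If the Koszul grade is positive, the top Koszul homology vanishes, so some `r ∈ (x)` is
`N`-regular; passing to `N/rN` lowers the Koszul grade by at most one. -/
theorem exists_isRegular_of_le_koszulGradeSeq [IsNoetherianRing S]
    (hx : ∀ i, x i ∈ maximalIdeal S) (k : ℕ) (N : Type v) [AddCommGroup N] [Module S N]
    [Module.Finite S N] [Nontrivial N] (h : (k : ℕ∞) ≤ koszulGradeSeq x N) :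
    ∃ rs : List S, rs.length = k ∧ (∀ r ∈ rs, r ∈ maximalIdeal S) ∧
      RingTheory.Sequence.IsRegular N rs := by
  have hI : Ideal.span (Set.range x) ≤ maximalIdeal S :=
    Ideal.span_le.2 (Set.range_subset_iff.2 hx)
  induction k generalizing N with
  | zero => exact ⟨[], rfl, by simp, .nil S N⟩
  | succ k ih =>
    rw [le_koszulGradeSeq_iff] at h
    obtain ⟨r, hrI, hr⟩ := exists_isSMulRegular_of_not_nontrivial x (M := N) fun hn => by
      have := h n hn
      rw [Nat.cast_le] at this
      omega
    have : Nontrivial (QuotSMulTop r N) := by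
      rw [Submodule.Quotient.nontrivial_iff]
      exact (Submodule.top_ne_pointwise_smul_of_mem_jacobson_annihilator
        (maximalIdeal_le_jacobson _ (hI hrI))).symm
    obtain ⟨rs, hlen, hmem, hreg⟩ := ih (QuotSMulTop r N) <| by
      rw [le_koszulGradeSeq_iff]
      intro j hj
      have hjn := le_of_nontrivial_koszulHomology x hj
      rw [Nat.cast_le]
      rcases nontrivial_koszulHomology_of_quotSMulTop x hr hj with h1 | ⟨i, rfl, h1⟩
      · have := h j h1
        rw [Nat.cast_le] at this
        omega
      · have := h i h1
        rw [Nat.cast_le] at this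
        omega
    refine ⟨r :: rs, by simp [hlen], ?_, (RingTheory.Sequence.isRegular_cons_iff _ _ _).2 ⟨hr, hreg⟩⟩
    simpa using ⟨hI hrI, hmem⟩

variable (N : Type v) [AddCommGroup N] [Module S N]

/-- The Koszul grade of a sequence in the maximal ideal is at most the depth. -/
theorem koszulGradeSeq_le_localDepth [IsNoetherianRing S] [Module.Finite S N] [Nontrivial N]
    (hx : ∀ i, x i ∈ maximalIdeal S) : koszulGradeSeq x N ≤ localDepth S N := by
  refine ENat.forall_natCast_le_iff_le.1 fun k hk => ?_
  obtain ⟨rs, rfl, hmem, hreg⟩ := exists_isRegular_of_le_koszulGradeSeq hx k N hk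
  exact le_localDepth hmem hreg

/-- The depth is at most the Koszul grade of a sequence generating an ideal whose radical contains
the maximal ideal. -/
theorem localDepth_le_koszulGradeSeq
    (hx : ∀ r ∈ maximalIdeal S, ∃ k, r ^ k ∈ Ideal.span (Set.range x)) :
    localDepth S N ≤ koszulGradeSeq x N := by
  refine (le_koszulGradeSeq_iff x).2 fun j hj => ?_
  refine iSup_le fun rs => iSup_le fun hm => iSup_le fun hreg => ?_
  have := add_length_le_of_isRegular x rs N hreg (fun r hr => hx r (hm r hr)) hj
  rw [Nat.cast_le]
  omega

/-- Nakayama's lemma: `H_0(x; N) = N / (x) N` is not zero. -/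
theorem nontrivial_koszulHomology_zero [Module.Finite S N] [Nontrivial N]
    (hx : ∀ i, x i ∈ maximalIdeal S) : Nontrivial (KoszulHomology x N 0) := by
  have hne : (⊤ : Submodule S N) ≠ maximalIdeal S • ⊤ :=
    Submodule.top_ne_ideal_smul_of_le_jacobson_annihilator (maximalIdeal_le_jacobson _)
  obtain ⟨v, -, hv⟩ := SetLike.exists_of_lt (lt_of_le_of_ne le_top hne.symm)
  have hz : Pi.single ∅ v ∈ koszulChains S n N 0 := single_mem_koszulChains ∅ v
  refine (nontrivial_koszulHomology_iff x).2
    ⟨Pi.single ∅ v, ⟨hz, koszulD_eq_zero_of_mem_chains_zero x hz⟩, ?_⟩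
  rintro ⟨c, -, hcz⟩
  refine hv ?_
  rw [← Pi.single_eq_same (M := fun _ : Finset (Fin n) => N) ∅ v, ← hcz, koszulD_apply]
  exact Submodule.sum_mem _ fun i _ => Submodule.smul_mem_smul
    (Ideal.mul_mem_left _ _ (hx i)) trivial

end DepthSensitivity

/-! ### The roots `R^{1/q}` inside the perfect closure -/

section PerfectRoot

variable (R : Type u) [CommRing R] (p : ℕ) [Fact p.Prime] [CharP R p]

/-- The ring homomorphism `a ↦ a^{1/q}`, `q = p ^ e`, from `R` to its perfect closure. Its range is
the copy of `R^{1/q}` in the perfect closure. -/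
noncomputable def perfectRoot (e : ℕ) : R →+* PerfectClosure R p :=
  (iterateFrobeniusEquiv (PerfectClosure R p) p e).symm.toRingHom.comp (PerfectClosure.of R p)

variable {R}

theorem perfectRoot_eq_iff {e : ℕ} {a : R} {y : PerfectClosure R p} :
    perfectRoot R p e a = y ↔ PerfectClosure.of R p a = y ^ p ^ e :=
  (iterateFrobeniusEquiv (PerfectClosure R p) p e).symm_apply_eq

theorem perfectRoot_pow (e : ℕ) (a : R) : perfectRoot R p e a ^ p ^ e = PerfectClosure.of R p a :=
  ((perfectRoot_eq_iff p).1 rfl).symm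

theorem perfectRoot_pow_char (e : ℕ) (a : R) :
    perfectRoot R p e (a ^ p ^ e) = PerfectClosure.of R p a :=
  (perfectRoot_eq_iff p).2 (map_pow _ _ _)

theorem perfectRoot_eq_of_le {e e' : ℕ} (h : e ≤ e') (a : R) :
    perfectRoot R p e' (a ^ p ^ (e' - e)) = perfectRoot R p e a := by
  rw [perfectRoot_eq_iff, map_pow, ← perfectRoot_pow p e, ← pow_mul, ← pow_add,
    Nat.add_sub_cancel' h]

theorem exists_perfectRoot_eq (y : PerfectClosure R p) :
    ∃ E, ∀ e ≥ E, ∃ a, perfectRoot R p e a = y := by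
  obtain ⟨k, a, ha⟩ := IsPRadical.pow_mem (i := PerfectClosure.of R p) (p := p) y
  exact ⟨k, fun e he => ⟨_, (perfectRoot_eq_of_le p he a).trans ((perfectRoot_eq_iff p).2 ha)⟩⟩

theorem algebraMap_perfectClosure_apply (r : R) :
    algebraMap R (PerfectClosure R p) r = PerfectClosure.of R p r :=
  rfl

variable (R)

/-- The inclusion of `R^{1/q}` into the perfect closure, as an `R`-linear map. -/
noncomputable def frobeniusRootToPerfectClosure (e : ℕ) :
    FrobeniusRoot R p e →ₗ[R] PerfectClosure R p where
  toFun a := perfectRoot R p e ((toFrobeniusRoot R p e).symm a)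
  map_add' a b := by rw [map_add, map_add]
  map_smul' r a := by
    rw [Algebra.smul_def, map_mul, map_mul, RingHom.id_apply, Algebra.smul_def,
      algebraMap_perfectClosure_apply, ← perfectRoot_pow_char p e r]
    rfl

end PerfectRoot

/-! ### Purity of the perfect closure -/

section Purity

variable {R : Type u} [CommRing R] {p : ℕ} [Fact p.Prime] [CharP R p]

theorem smul_toFrobeniusRoot (e : ℕ) (r a : R) :
    r • toFrobeniusRoot R p e a = toFrobeniusRoot R p e (r ^ p ^ e * a) :=
  Algebra.smul_def _ _

section FrobeniusFunctor

variable (p) {M : Type v} [AddCommGroup M] [Module R M]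

/-- The element `a^{1/q} ⊗ m` of `F^e(M)`. -/
def FrobeniusFunctor.tmul (e : ℕ) (a : R) (m : M) : FrobeniusFunctor R p M e :=
  (toFrobeniusRoot R p e a ⊗ₜ[R] m : FrobeniusRoot R p e ⊗[R] M)

namespace FrobeniusFunctor

theorem smul_tmul (e : ℕ) (r a : R) (m : M) : r • tmul p e a m = tmul p e (r * a) m := rfl

theorem tmul_add (e : ℕ) (a : R) (m n : M) : tmul p e a (m + n) = tmul p e a m + tmul p e a n :=
  TensorProduct.tmul_add _ _ _

theorem tmul_smul (e : ℕ) (r a : R) (m : M) : tmul p e a (r • m) = tmul p e (r ^ p ^ e * a) m := by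
  rw [tmul, ← TensorProduct.smul_tmul, smul_toFrobeniusRoot]
  rfl

theorem induction_on {e : ℕ} {P : FrobeniusFunctor R p M e → Prop} (z : FrobeniusFunctor R p M e)
    (zero : P 0) (tmul : ∀ a m, P (tmul p e a m)) (add : ∀ y z, P y → P z → P (y + z)) : P z :=
  TensorProduct.induction_on (motive := P) z zero
    (fun a m => tmul ((toFrobeniusRoot R p e).symm a) m) add

instance finite [Module.Finite R M] (e : ℕ) : Module.Finite R (FrobeniusFunctor R p M e) := by
  have : RingHomSurjective (toFrobeniusRoot R p e).symm.toRingHom :=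
    ⟨(toFrobeniusRoot R p e).symm.surjective⟩
  let φ : (FrobeniusRoot R p e ⊗[R] M) →ₛₗ[(toFrobeniusRoot R p e).symm.toRingHom]
      FrobeniusFunctor R p M e :=
    { toFun := fun z => z
      map_add' := fun _ _ => rfl
      map_smul' := fun _ _ => rfl }
  exact Module.Finite.of_surjective φ fun z => ⟨z, rfl⟩

variable (R M)

/-- The map `F^e(M) → R^∞ ⊗ M`, semilinear along `a ↦ a^{1/q}`. -/
noncomputable def toPerfectClosure (e : ℕ) :
    FrobeniusFunctor R p M e →ₛₗ[perfectRoot R p e] PerfectClosure R p ⊗[R] M :=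
  let f : FrobeniusFunctor R p M e →+ PerfectClosure R p ⊗[R] M :=
    ((frobeniusRootToPerfectClosure R p e).rTensor M).toAddMonoidHom
  have hf (a : R) (m : M) : f (tmul p e a m) = perfectRoot R p e a ⊗ₜ[R] m := rfl
  { f with
    map_smul' := fun r z => by
      change f (r • z) = perfectRoot R p e r • f z
      induction z using induction_on with
      | zero => rw [smul_zero, map_zero, smul_zero]
      | tmul a m =>
        rw [smul_tmul, hf, hf, map_mul, TensorProduct.smul_tmul', smul_eq_mul]
      | add y z hy hz => rw [smul_add, map_add, hy, hz, map_add, smul_add] }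

variable {R M}

theorem toPerfectClosure_tmul (e : ℕ) (a : R) (m : M) :
    toPerfectClosure R p M e (tmul p e a m) = perfectRoot R p e a ⊗ₜ[R] m :=
  rfl

/-- `R^∞ ⊗ M` is the increasing union of the images of the `F^e(M)`. -/
theorem exists_toPerfectClosure_eq (t : PerfectClosure R p ⊗[R] M) :
    ∃ E, ∀ e ≥ E, t ∈ Set.range (toPerfectClosure R p M e) := by
  induction t with
  | zero => exact ⟨0, fun e _ => ⟨0, map_zero _⟩⟩
  | tmul b m =>
    obtain ⟨E, hE⟩ := exists_perfectRoot_eq p b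
    refine ⟨E, fun e he => ?_⟩
    obtain ⟨a, rfl⟩ := hE e he
    exact ⟨tmul p e a m, rfl⟩
  | add y z hy hz =>
    obtain ⟨E, hE⟩ := hy
    obtain ⟨E', hE'⟩ := hz
    refine ⟨max E E', fun e he => ?_⟩
    obtain ⟨a, rfl⟩ := hE e (le_trans (le_max_left _ _) he)
    obtain ⟨b, rfl⟩ := hE' e (le_trans (le_max_right _ _) he)
    exact ⟨a + b, map_add _ _ _⟩

/-- The additive map `R^∞ ⊗ M → R^∞ ⊗ Q` induced by an `R`-linear map `u : F^e(M) → Q`, given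
by `b ⊗ m ↦ b ^ q ⊗ u (1 ⊗ m)`. The tensor product `R^∞ ⊗ M` is the base change of `F^e(M)` along
`a ↦ a^{1/q}`; raising to the power `q` turns that `R`-algebra structure of `R^∞` into the usual one,
so that the target is again a tensor product with respect to the latter. -/
noncomputable def liftPerfectClosure {Q : Type w} [AddCommGroup Q] [Module R Q] {e : ℕ}
    (u : FrobeniusFunctor R p M e →ₗ[R] Q) :
    PerfectClosure R p ⊗[R] M →+ PerfectClosure R p ⊗[R] Q :=
  TensorProduct.liftAddHom
    (AddMonoidHom.mk'
      (fun b => AddMonoidHom.mk' (fun m => (b ^ p ^ e) ⊗ₜ[R] u (tmul p e 1 m))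
        (fun m n => by rw [tmul_add, map_add, TensorProduct.tmul_add]))
      (fun b c => by
        ext m
        simp [add_pow_char_pow, TensorProduct.add_tmul]))
    (fun r b m => by
      simp only [AddMonoidHom.mk'_apply]
      rw [tmul_smul, ← smul_tmul, map_smul, TensorProduct.tmul_smul, smul_pow,
        TensorProduct.smul_tmul'])

variable {Q : Type w} [AddCommGroup Q] [Module R Q] {e : ℕ}
  (u : FrobeniusFunctor R p M e →ₗ[R] Q)

theorem liftPerfectClosure_tmul (b : PerfectClosure R p) (m : M) :
    liftPerfectClosure p u (b ⊗ₜ m) = (b ^ p ^ e) ⊗ₜ[R] u (tmul p e 1 m) :=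
  rfl

theorem liftPerfectClosure_smul (a : R) (t : PerfectClosure R p ⊗[R] M) :
    liftPerfectClosure p u (perfectRoot R p e a • t) = a • liftPerfectClosure p u t := by
  induction t with
  | zero => simp
  | tmul b m =>
    rw [TensorProduct.smul_tmul', liftPerfectClosure_tmul, liftPerfectClosure_tmul, smul_eq_mul,
      mul_pow, perfectRoot_pow, TensorProduct.smul_tmul', Algebra.smul_def]
    rfl
  | add y z hy hz => rw [smul_add, map_add, hy, hz, map_add, smul_add]

theorem liftPerfectClosure_toPerfectClosure (z : FrobeniusFunctor R p M e) :
    liftPerfectClosure p u (toPerfectClosure R p M e z) = 1 ⊗ₜ u z := by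
  induction z using induction_on with
  | zero => simp
  | tmul a m =>
    rw [toPerfectClosure_tmul, liftPerfectClosure_tmul, perfectRoot_pow, ← mul_one a, ← smul_tmul,
      map_smul, TensorProduct.tmul_smul, TensorProduct.smul_tmul', Algebra.smul_def, mul_one,
      mul_one]
    rfl
  | add y z hy hz => rw [map_add, map_add, hy, hz, map_add, TensorProduct.tmul_add]

end FrobeniusFunctor

end FrobeniusFunctor

/-- Iterating F-purity: `R → R^{1/q}` is pure for all `q`. -/
theorem IsFPure.eq_zero_of_frobeniusRoot (hR : IsFPure R p) (e : ℕ) {Q : Type u} [AddCommGroup Q]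
    [Module R Q] {y : Q} (h : FrobeniusFunctor.tmul p e (1 : R) y = 0) : y = 0 := by
  induction e with
  | zero =>
    let φ : FrobeniusRoot R p 0 →ₗ[R] R :=
      { toFun := fun a => (toFrobeniusRoot R p 0).symm a
        map_add' := map_add _
        map_smul' := fun r a => by
          rw [Algebra.smul_def, map_mul]
          have : (toFrobeniusRoot R p 0).symm (algebraMap R (FrobeniusRoot R p 0) r) = r ^ p ^ 0 :=
            rfl
          rw [this, pow_zero, pow_one]
          rfl }
    have h2 := congrArg (TensorProduct.lid R Q) (congrArg (φ.rTensor Q) h)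
    have h3 : TensorProduct.lid R Q (φ.rTensor Q (FrobeniusFunctor.tmul p 0 (1 : R) y)) =
      (1 : R) • y := rfl
    rw [h3, one_smul] at h2
    exact h2.trans ((congrArg _ (map_zero _)).trans (map_zero _))
  | succ e ih =>
    refine ih ?_
    let Φ : FrobeniusRoot R p (e + 1) ⊗[R] Q →+
        FrobeniusRoot R p 1 ⊗[R] FrobeniusFunctor R p Q e :=
      TensorProduct.liftAddHom
        (AddMonoidHom.mk'
          (fun a => AddMonoidHom.mk'
            (fun m => toFrobeniusRoot R p 1 ((toFrobeniusRoot R p (e + 1)).symm a) ⊗ₜ[R]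
              FrobeniusFunctor.tmul p e (1 : R) m)
            (fun m n => by rw [FrobeniusFunctor.tmul_add, TensorProduct.tmul_add]))
          (fun b c => by
            ext m
            simp [TensorProduct.add_tmul]))
        (fun r a m => by
          obtain ⟨a, rfl⟩ := (toFrobeniusRoot R p (e + 1)).surjective a
          simp only [AddMonoidHom.mk'_apply]
          rw [FrobeniusFunctor.tmul_smul, ← FrobeniusFunctor.smul_tmul, smul_toFrobeniusRoot,
            TensorProduct.tmul_smul, TensorProduct.smul_tmul', smul_toFrobeniusRoot, ← pow_mul,
            ← pow_add]
          rfl)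
    have h1 : (1 : FrobeniusRoot R p 1) ⊗ₜ[R] FrobeniusFunctor.tmul p e (1 : R) y = 0 :=
      (congrArg Φ h).trans (map_zero Φ)
    have hinj := hR (FrobeniusFunctor R p Q e)
    have h4 : (1 : R) ⊗ₜ[R] FrobeniusFunctor.tmul p e (1 : R) y = 0 := hinj <| by
      rw [LinearMap.rTensor_tmul, map_zero, Algebra.linearMap_apply, map_one, h1]
    have := congrArg (TensorProduct.lid R _) h4
    rwa [TensorProduct.lid_tmul, one_smul, map_zero] at this

theorem IsFPure.of_injective (hR : IsFPure R p) : Function.Injective (PerfectClosure.of R p) := by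
  refine (injective_iff_map_eq_zero _).2 fun a ha => ?_
  obtain ⟨k, hk⟩ := mem_pNilradical.1 (IsPRadical.ker_le (PerfectClosure.of R p) p ha)
  refine hR.eq_zero_of_frobeniusRoot k (y := a) ?_
  rw [← mul_one a, ← smul_eq_mul, FrobeniusFunctor.tmul_smul, hk, zero_mul]
  exact TensorProduct.zero_tmul _ _

/-- A vanishing in `R^∞ ⊗ Q` takes place in some `R^{1/q} ⊗ Q`, so `R → R^∞` is pure. -/
theorem IsFPure.eq_zero_of_perfectClosure (hR : IsFPure R p) {Q : Type u} [AddCommGroup Q]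
    [Module R Q] {y : Q} (h : (1 : PerfectClosure R p) ⊗ₜ[R] y = 0) : y = 0 := by
  let P₀ : Submodule R (PerfectClosure R p) := Submodule.span R {1}
  obtain ⟨P₁, hle, ⟨s, hs⟩, h1⟩ := TensorProduct.eq_zero_of_fg_of_subtype_eq_zero
    (P := P₀) (Submodule.fg_span_singleton 1)
    (t := (⟨1, Submodule.mem_span_singleton_self 1⟩ : P₀) ⊗ₜ[R] y) h
  choose E hE using fun b : PerfectClosure R p => exists_perfectRoot_eq p b
  let k := s.sup E
  let L := frobeniusRootToPerfectClosure R p k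
  have hL : Function.Injective L := fun a b hab => by
    refine (toFrobeniusRoot R p k).symm.injective (hR.of_injective ?_)
    rw [← perfectRoot_pow p k, ← perfectRoot_pow p k]
    exact congrArg (· ^ p ^ k) hab
  have hP₁ : P₁ ≤ LinearMap.range L := by
    rw [← hs, Submodule.span_le]
    intro b hb
    obtain ⟨a, ha⟩ := hE b k (Finset.le_sup hb)
    exact ⟨toFrobeniusRoot R p k a, ha⟩
  let ψ : P₁ →ₗ[R] FrobeniusRoot R p k :=
    (LinearEquiv.ofInjective L hL).symm.toLinearMap ∘ₗ Submodule.inclusion hP₁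
  have hψ : ψ ⟨1, hle (Submodule.mem_span_singleton_self 1)⟩ = toFrobeniusRoot R p k 1 := by
    refine (LinearEquiv.symm_apply_eq _).2 (Subtype.ext ?_)
    exact (map_one (perfectRoot R p k)).symm
  have h2 := congrArg (ψ.rTensor Q) h1
  rw [LinearMap.rTensor_tmul, LinearMap.rTensor_tmul, map_zero] at h2
  refine hR.eq_zero_of_frobeniusRoot k ((congrArg (· ⊗ₜ[R] y) hψ.symm).trans h2)

/-- Purity of `R → R^∞` tested on finite modules, which may live in any universe since they are
isomorphic to modules in the universe of `R`. -/
theorem IsFPure.eq_zero_of_finite (hR : IsFPure R p) {Q : Type w} [AddCommGroup Q]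
    [Module R Q] [Module.Finite R Q] {y : Q} (h : (1 : PerfectClosure R p) ⊗ₜ[R] y = 0) :
    y = 0 := by
  have := Module.Finite.small.{u} R Q
  refine (Shrink.linearEquiv R Q).symm.map_eq_zero_iff.1 (hR.eq_zero_of_perfectClosure (p := p) ?_)
  rw [← LinearEquiv.coe_coe, ← LinearMap.lTensor_tmul, h, map_zero]

end Purity

/-! ### Koszul homology of the Frobenius powers and of `R^∞ ⊗ M` -/

section Comparison

open FrobeniusFunctor

variable {R : Type u} [CommRing R] {p : ℕ} [Fact p.Prime] [CharP R p]
  {M : Type v} [AddCommGroup M] [Module R M] [Module.Finite R M] {n : ℕ}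

theorem toPerfectClosure_injective (hR : IsFPure R p) (e : ℕ) :
    Function.Injective (toPerfectClosure R p M e) := by
  refine (injective_iff_map_eq_zero _).2 fun z hz => hR.eq_zero_of_finite (p := p) ?_
  have := liftPerfectClosure_toPerfectClosure p LinearMap.id z
  rw [hz, map_zero] at this
  exact this.symm

theorem nontrivial_frobeniusFunctor [Nontrivial M] (hR : IsFPure R p) (e : ℕ) :
    Nontrivial (FrobeniusFunctor R p M e) := by
  obtain ⟨m, hm⟩ := exists_ne (0 : M)
  refine ⟨tmul p e 1 m, 0, fun h => hm (hR.eq_zero_of_finite (p := p) ?_)⟩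
  have := congrArg (toPerfectClosure R p M e) h
  rwa [toPerfectClosure_tmul, map_one, map_zero] at this

/-- Purity makes a system of linear equations over `F^e(M)` solvable as soon as it is solvable in
`R^∞ ⊗ M`; in particular chains which become boundaries are boundaries. -/
theorem mem_koszulBoundaries_of_toPerfectClosure (hR : IsFPure R p) {e : ℕ} (x : Fin n → R) {j : ℕ}
    {c : Finset (Fin n) → FrobeniusFunctor R p M e}
    (h : toPerfectClosure R p M e ∘ c ∈
      koszulBoundaries (perfectRoot R p e ∘ x) (PerfectClosure R p ⊗[R] M) j) :
    c ∈ koszulBoundaries x (FrobeniusFunctor R p M e) j := by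
  obtain ⟨b, hb, hbc⟩ := h
  let B := koszulBoundaries x (FrobeniusFunctor R p M e) j
  let u (s : Finset (Fin n)) : FrobeniusFunctor R p M e →ₗ[R] _ :=
    B.mkQ ∘ₗ LinearMap.single R (fun _ => FrobeniusFunctor R p M e) s
  have hu (c : Finset (Fin n) → FrobeniusFunctor R p M e) : ∑ s, u s (c s) = B.mkQ c := by
    simp only [u, LinearMap.comp_apply, ← map_sum, LinearMap.coe_single, Finset.univ_sum_single]
  rw [← Submodule.Quotient.mk_eq_zero]
  refine hR.eq_zero_of_finite (p := p) ?_
  change 1 ⊗ₜ[R] (B.mkQ c) = 0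
  have h1 : ∑ s, liftPerfectClosure p (u s) ((toPerfectClosure R p M e ∘ c) s) =
      1 ⊗ₜ[R] (B.mkQ c) := by
    simp only [Function.comp_apply, liftPerfectClosure_toPerfectClosure, ← hu,
      TensorProduct.tmul_sum]
  rw [← h1, ← hbc]
  -- The contribution of the component `b t` is governed by the `t`-th column of the differential,
  -- that is, by the boundary of a chain supported on `t`.
  simp only [koszulD_comp_eq_sum, map_sum, liftPerfectClosure_smul]
  rw [Finset.sum_comm]
  refine Finset.sum_eq_zero fun t _ => ?_
  by_cases ht : t.card = j + 1
  · generalize b t = v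
    induction v with
    | zero => simp
    | tmul β m =>
      simp only [liftPerfectClosure_tmul, ← TensorProduct.tmul_smul, ← TensorProduct.tmul_sum]
      have hd : koszulD x _ (Pi.single t (tmul p e 1 m)) ∈ B :=
        ⟨_, ht ▸ single_mem_koszulChains t _, rfl⟩
      rw [← Submodule.Quotient.mk_eq_zero, ← Submodule.mkQ_apply, koszulD_single, map_sum] at hd
      simp only [map_smul] at hd
      exact (congrArg _ hd).trans (TensorProduct.tmul_zero _ _)
    | add y z hy hz => simp only [map_add, smul_add, Finset.sum_add_distrib, hy, hz, add_zero]
  · simp [hb t ht]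

theorem nontrivial_koszulHomology_perfectClosure (hR : IsFPure R p) {e : ℕ} (x : Fin n → R) {j : ℕ}
    (h : Nontrivial (KoszulHomology x (FrobeniusFunctor R p M e) j)) :
    Nontrivial (KoszulHomology (perfectRoot R p e ∘ x) (PerfectClosure R p ⊗[R] M) j) := by
  rw [nontrivial_koszulHomology_iff] at h ⊢
  obtain ⟨z, hz, hzB⟩ := h
  rw [mem_koszulCycles] at hz
  refine ⟨_, (mem_koszulCycles _).2
    ⟨comp_mem_koszulChains (toPerfectClosure R p M e) hz.1, ?_⟩,
    fun hB => hzB (mem_koszulBoundaries_of_toPerfectClosure hR x hB)⟩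
  rw [koszulD_map, hz.2]
  funext s
  simp

/-- A nonzero class over `R^∞` is defined, and is nonzero, over `F^e(M)` for all large `e`. -/
theorem eventually_nontrivial_koszulHomology (hR : IsFPure R p) {ξ : Fin n → PerfectClosure R p}
    {j : ℕ} (h : Nontrivial (KoszulHomology ξ (PerfectClosure R p ⊗[R] M) j)) :
    ∀ᶠ e in Filter.atTop, ∀ x : Fin n → R, perfectRoot R p e ∘ x = ξ →
      Nontrivial (KoszulHomology x (FrobeniusFunctor R p M e) j) := by
  rw [nontrivial_koszulHomology_iff] at h
  obtain ⟨z, hz, hzB⟩ := h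
  rw [mem_koszulCycles] at hz
  have hev : ∀ᶠ e in Filter.atTop, ∀ s, z s ∈ Set.range (toPerfectClosure R p M e) :=
    Filter.eventually_all.2 fun s => Filter.eventually_atTop.2 (exists_toPerfectClosure_eq p (z s))
  filter_upwards [hev] with e he x hx
  subst hx
  obtain ⟨c, hc, rfl⟩ := exists_lift_mem_koszulChains (toPerfectClosure R p M e) hz.1 he
  refine (nontrivial_koszulHomology_iff x).2 ⟨c, (mem_koszulCycles x).2 ⟨hc, ?_⟩,
    fun hB => hzB (comp_mem_koszulBoundaries x _ hB)⟩
  have := hz.2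
  rw [koszulD_map] at this
  funext s
  exact toPerfectClosure_injective hR e ((congrFun this s).trans (map_zero _).symm)

end Comparison

/-! ### The stabilizing depth -/

section Stabilizing

open IsLocalRing

variable {R : Type u} [CommRing R] {p : ℕ} [Fact p.Prime] [CharP R p] [IsLocalRing R]

theorem perfectRoot_mem_maximalIdeal_iff (hR : IsFPure R p) {e : ℕ} {a : R} :
    perfectRoot R p e a ∈ maximalIdeal (PerfectClosure R p) ↔ a ∈ maximalIdeal R := by
  rw [mem_maximalIdeal, mem_maximalIdeal, mem_nonunits_iff, mem_nonunits_iff, not_iff_not]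
  refine ⟨fun h => ?_, fun h => h.map _⟩
  obtain ⟨b, hb⟩ := h.exists_right_inv
  obtain ⟨E, hE⟩ := exists_perfectRoot_eq p b
  obtain ⟨b, rfl⟩ := hE (max E e) (le_max_left _ _)
  rw [← perfectRoot_eq_of_le p (le_max_right E e), ← map_mul, perfectRoot_eq_iff, one_pow,
    ← map_one (PerfectClosure.of R p)] at hb
  exact (isUnit_pow_iff (pow_ne_zero _ (Fact.out : p.Prime).ne_zero)).1
    (IsUnit.of_mul_eq_one _ (hR.of_injective hb))

variable {M : Type v} [AddCommGroup M] [Module R M] [Module.Finite R M] [Nontrivial M]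

theorem koszulGradeSeq_perfectClosure_le (hR : IsFPure R p) {n : ℕ} {y : Fin n → R}
    (hy : ∀ i, y i ∈ maximalIdeal R) :
    koszulGradeSeq (PerfectClosure.of R p ∘ y) (PerfectClosure R p ⊗[R] M) ≤ n := by
  have := nontrivial_frobeniusFunctor (M := M) hR 0
  have h := nontrivial_koszulHomology_perfectClosure hR y
    (nontrivial_koszulHomology_zero (FrobeniusFunctor R p M 0) hy)
  have h0 : perfectRoot R p 0 ∘ y = PerfectClosure.of R p ∘ y :=
    funext fun i => (perfectRoot_eq_iff p).2 (by simp)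
  rw [h0] at h
  exact koszulGradeSeq_le _ h

variable [IsNoetherianRing R]

/-- For large `e`, the depth of `F^e(M)` is the Koszul grade of generators `y` of the maximal ideal of
`R` on `R^∞ ⊗ M`: it is the Koszul grade of the powers `y i ^ q` on `F^e(M)`, and the `q`-th root of
`y i ^ q` is `y i`. -/
theorem eventually_localDepth_eq (hR : IsFPure R p) {n : ℕ} {y : Fin n → R}
    (hy : Ideal.span (Set.range y) = maximalIdeal R) :
    ∀ᶠ e in Filter.atTop, localDepth R (FrobeniusFunctor R p M e) =
      koszulGradeSeq (PerfectClosure.of R p ∘ y) (PerfectClosure R p ⊗[R] M) := by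
  have hym (i) : y i ∈ maximalIdeal R := hy ▸ Ideal.subset_span ⟨i, rfl⟩
  have hev : ∀ᶠ e in Filter.atTop, ∀ j ∈ Finset.range (n + 1),
      Nontrivial (KoszulHomology (PerfectClosure.of R p ∘ y) (PerfectClosure R p ⊗[R] M) j) →
      ∀ x : Fin n → R, perfectRoot R p e ∘ x = PerfectClosure.of R p ∘ y →
      Nontrivial (KoszulHomology x (FrobeniusFunctor R p M e) j) := by
    refine (Filter.eventually_all_finset _).2 fun j _ => ?_
    by_cases h : Nontrivial
        (KoszulHomology (PerfectClosure.of R p ∘ y) (PerfectClosure R p ⊗[R] M) j)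
    · exact (eventually_nontrivial_koszulHomology hR h).mono fun e he _ => he
    · exact Filter.Eventually.of_forall fun e h' => absurd h' h
  filter_upwards [hev] with e he
  have := nontrivial_frobeniusFunctor (M := M) hR e
  let x : Fin n → R := fun i => y i ^ p ^ e
  have hpe : p ^ e ≠ 0 := pow_ne_zero _ (Fact.out : p.Prime).ne_zero
  have hxy : perfectRoot R p e ∘ x = PerfectClosure.of R p ∘ y :=
    funext fun i => perfectRoot_pow_char p e (y i)
  have hxm (i) : x i ∈ maximalIdeal R := Ideal.pow_mem_of_mem _ (hym i) _ (Nat.pos_of_ne_zero hpe)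
  have hrad : ∀ r ∈ maximalIdeal R, ∃ k, r ^ k ∈ Ideal.span (Set.range x) := by
    have : maximalIdeal R ≤ (Ideal.span (Set.range x)).radical := by
      rw [← hy, Ideal.span_le]
      rintro _ ⟨i, rfl⟩
      exact ⟨p ^ e, Ideal.subset_span ⟨i, rfl⟩⟩
    exact this
  refine ((localDepth_le_koszulGradeSeq _ hrad).antisymm
    (koszulGradeSeq_le_localDepth _ hxm)).trans ?_
  refine le_antisymm (koszulGradeSeq_le_of_imp x fun j hj => ?_)
    (koszulGradeSeq_le_of_imp _ fun j hj => ?_)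
  · exact he j (Finset.mem_range_succ_iff.2 (le_of_nontrivial_koszulHomology _ hj)) hj x hxy
  · rw [← hxy]
    exact nontrivial_koszulHomology_perfectClosure hR x hj

/-- The Koszul depth of `R^∞ ⊗ M` is attained by generators of the maximal ideal of `R`: a finite
sequence in `m^∞` comes from `R^{1/q}` for some large `q`, and its Koszul grade is at most the depth
of `F^e(M)`. -/
theorem koszulDepth_eq_koszulGradeSeq (hR : IsFPure R p) {n : ℕ} {y : Fin n → R}
    (hy : Ideal.span (Set.range y) = maximalIdeal R) :
    koszulDepth (PerfectClosure R p) (PerfectClosure R p ⊗[R] M) =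
      koszulGradeSeq (PerfectClosure.of R p ∘ y) (PerfectClosure R p ⊗[R] M) := by
  refine le_antisymm (iSup_le fun k => iSup_le fun ξ => iSup_le fun hξ => ?_)
    (le_iSup_of_le n (le_iSup_of_le _ (le_iSup_of_le (fun i => ?_) le_rfl)))
  · have hev : ∀ᶠ e in Filter.atTop, ∀ i, ∃ a, perfectRoot R p e a = ξ i :=
      Filter.eventually_all.2 fun i => Filter.eventually_atTop.2 (exists_perfectRoot_eq p (ξ i))
    obtain ⟨e, he, hdepth⟩ := (hev.and (eventually_localDepth_eq (M := M) hR hy)).exists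
    choose x hx using he
    obtain rfl : perfectRoot R p e ∘ x = ξ := funext hx
    have := nontrivial_frobeniusFunctor (M := M) hR e
    rw [← hdepth]
    exact (koszulGradeSeq_le_of_imp _ fun j hj =>
      nontrivial_koszulHomology_perfectClosure hR x hj).trans
      (koszulGradeSeq_le_localDepth _ fun i => (perfectRoot_mem_maximalIdeal_iff hR).1 (hξ i))
  · have hi : y i ∈ maximalIdeal R := hy ▸ Ideal.subset_span ⟨i, rfl⟩
    rw [Function.comp_apply, ← perfectRoot_pow_char p 0]
    exact (perfectRoot_mem_maximalIdeal_iff hR).2 (by simpa using hi)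

end Stabilizing

theorem mainTheorem2 (p : ℕ) [Fact p.Prime] (R : Type*) [CommRing R] [CharP R p]
    [IsNoetherianRing R] [IsLocalRing R] (hR : IsFPure R p)
    (M : Type*) [AddCommGroup M] [Module R M] [Module.Finite R M] [Nontrivial M] :
    (∀ᶠ e : ℕ in Filter.atTop,
        localDepth R (FrobeniusFunctor R p M e) = stabilizingDepth R p M) ∧
      koszulDepth (PerfectClosure R p) (PerfectClosure R p ⊗[R] M) ≠ ⊤ ∧
      koszulDepth (PerfectClosure R p) (PerfectClosure R p ⊗[R] M) = stabilizingDepth R p M := by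
  obtain ⟨n, y, hy⟩ := Submodule.fg_iff_exists_fin_generating_family.1
    (IsNoetherian.noetherian (IsLocalRing.maximalIdeal R))
  have hev := eventually_localDepth_eq (M := M) hR hy
  have hs : stabilizingDepth R p M =
      koszulGradeSeq (PerfectClosure.of R p ∘ y) (PerfectClosure R p ⊗[R] M) :=
    (Filter.limsup_congr hev).trans (Filter.limsup_const _)
  rw [koszulDepth_eq_koszulGradeSeq hR hy, hs]
  refine ⟨hev, ne_top_of_le_ne_top (ENat.natCast_ne_top n) ?_, rfl⟩
  exact koszulGradeSeq_perfectClosure_le hR fun i => hy ▸ Ideal.subset_span ⟨i, rfl⟩
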